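/- Let $G_0$ be a connected (finite-dimensional, real) Lie group with Lie algebra $\mathfrak g_0$, let $\mathfrak g=\mathfrak g_0\otimes_{\mathbb R}\mathbb C$, $n=\dim_{\mathbb C}\mathfrak g$, and let $\mathfrak g^*=\mathfrak g_0^*+i\,\mathfrak g_0^*$ be the complex dual of $\mathfrak g$, with the complex conjugation $z\mapsto\bar z$ given by $\mathfrak g_0$ and with the action of $G_0$ that is the coadjoint action on both real and imaginary parts. For $z\in\mathfrak g^*$ let $c(z)$ be the skew form $(u,w)\mapsto z([u,w])$ on $\mathfrak g=(T^{1,0}_z\mathfrak g^*)^*$ (the value at $z$ of the linear holomorphic Poisson bivector $c=c_{ij}^kz_k\,\partial_{z_i}\wedge\partial_{z_j}$), and let $\tilde c(z)=c(\bar z)$. Put - $R_0=\max_z\operatorname{rank}c(z)$ and $r=\operatorname{rank}\mathfrak g:=n-R_0$; - $\operatorname{Sing}\mathfrak g^*=\{z:\operatorname{rank}c(z)<R_0\}$, and $\mathcal C=\{z:\lambda_1z+\lambda_2\bar z\in\operatorname{Sing}\mathfrak g^*\text{ for some }(\lambda_1,\lambda_2)\in\mathbb C^2\setminus\{(0,0)\}\}$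 (the incompleteness set); - $\mu(z)=\dim_{\mathbb C}(\ker c(z)\cap\ker\tilde c(z))$ and $\mu=\min_{z}\mu(z)$ (the trivial Kronecker dimension of $\mathfrak g$); - $\mathcal R$, the Kronecker irregularity set: the smallest real algebraic subset of $\mathfrak g^*$ that contains $\mathcal C$ and is such that $\mu(z)=\mu$ for all $z\notin\mathcal R$. Let $\mathcal O\subset\mathfrak g^*$ be a $G_0$-orbit lying in the complement of $\mathcal R$, with tangent spaces $T_z\mathcal O\subset\mathfrak g^*$ (images of the differentials at $1$ of the orbit maps $g\mapsto z\cdot g$), and for $z\in\mathcal O$ let $T^{1,0}_z\mathcal O=(T_z\mathcal O\otimes_{\mathbb R}\mathbb C)\cap T^{1,0}_z\mathfrak g^*$. Then, for every $z\in\mathcal O$: (i) $\dim_{\mathbb C}T^{1,0}_z\mathcal O=r-\mu$; in particular, if $\mathfrak g$ is semisimple, then $\dim_{\mathbb C}T^{1,0}_z\mathcal O=r$; (ii) $\dim_{\mathbb R}\mathcal O=\dim_{\mathbb R}T_z\mathcal O=n-\mu$. -/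

import Mathlib

open scoped Manifold ContDiff TensorProduct

noncomputable section

/-! ### The canonical pair of bivectors on the dual of a complexified Lie algebra

`L` is a real Lie algebra `𝔤₀`, and `𝔤 = ℂ ⊗[ℝ] L` its complexification. The complex dual `𝔤^*`
is identified with the space `L →L[ℝ] ℂ` of real-linear forms `z = a + i b` (`a, b ∈ 𝔤₀^*`) through
`ℂ`-linear extension; the complex conjugation of `𝔤^*` with respect to the real form is then
`z ↦ conj ∘ z`. -/

section Algebra

/-- The complexification `𝔤` of `𝔤₀`. -/
abbrev Complexified (L : Type*) [AddCommGroup L] [Module ℝ L] : Type _ := ℂ ⊗[ℝ] L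

/-- The complex dual `𝔤^* = 𝔤₀^* + i 𝔤₀^*` of the complexification. -/
abbrev ComplexDual (L : Type*) [AddCommGroup L] [Module ℝ L] [TopologicalSpace L] : Type _ :=
  L →L[ℝ] ℂ

variable {L : Type*} [LieRing L] [LieAlgebra ℝ L] [TopologicalSpace L]

/-- The `ℂ`-linear form on `𝔤` given by `z ∈ 𝔤^*`. -/
def ComplexDual.extend (z : ComplexDual L) : Complexified L →ₗ[ℂ] ℂ :=
  LinearMap.liftBaseChange ℂ (z : L →ₗ[ℝ] ℂ)

/-- The complex conjugation of `𝔤^*` with respect to the real form. -/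
def ComplexDual.conj (z : ComplexDual L) : ComplexDual L :=
  (Complex.conjCLE : ℂ →L[ℝ] ℂ).comp z

/-- The holomorphic linear bivector `c = c_{ij}^k z_k ∂_i ∧ ∂_j` on `𝔤^*`, at the point `z`, as the
sharp map from `(T_z^{1,0} 𝔤^*)^* = 𝔤` to `T_z^{1,0} 𝔤^* = 𝔤^*`: it takes `u` to `w ↦ z ([u, w])`. -/
def linearBivector (z : ComplexDual L) :
    Complexified L →ₗ[ℂ] Module.Dual ℂ (Complexified L) :=
  (LieModule.toEnd ℂ (Complexified L) (Complexified L) :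
    Complexified L →ₗ[ℂ] Module.End ℂ (Complexified L)).compr₂ z.extend

/-- The bivector `c̃ = c_{ij}^k z̄_k ∂_i ∧ ∂_j` on `𝔤^*`. -/
def conjBivector (z : ComplexDual L) :
    Complexified L →ₗ[ℂ] Module.Dual ℂ (Complexified L) :=
  linearBivector z.conj

/-- The rank of `c` at `z`, which is the complex dimension of the symplectic leaf through `z`. -/
def bivectorRank (z : ComplexDual L) : ℕ :=
  Module.finrank ℂ (LinearMap.range (linearBivector z))

variable (L) in
/-- The rank of `c`: the maximum of its ranks at all points. -/
def maxBivectorRank : ℕ := ⨆ z : ComplexDual L, bivectorRank z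

variable (L) in
/-- The rank of `𝔤`: the corank of `c`, i.e. the complex codimension of the symplectic leaves of
maximal dimension. -/
def algebraRank : ℕ := Module.finrank ℂ (Complexified L) - maxBivectorRank L

variable (L) in
/-- The union `Sing 𝔤^*` of the symplectic leaves of nonmaximal dimension. -/
def singularSet : Set (ComplexDual L) := {z | bivectorRank z < maxBivectorRank L}

variable (L) in
/-- The incompleteness set: the points `z` such that some nontrivial complex combination of `z` and
`z̄` is singular. -/
def incompletenessSet : Set (ComplexDual L) :=
  {z | ∃ a b : ℂ, (a, b) ≠ (0, 0) ∧ a • z + b • z.conj ∈ singularSet L}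

/-- The number `μ(z) = dim (ker c(z))^{1,0} ∩ (ker c̃(z))^{1,0}`. -/
def kroneckerDimAt (z : ComplexDual L) : ℕ :=
  Module.finrank ℂ ↥(LinearMap.ker (linearBivector z) ⊓ LinearMap.ker (conjBivector z))

variable (L) in
/-- The trivial Kronecker dimension `μ` of `𝔤`: the minimal value of `μ(z)`. -/
def trivialKroneckerDim : ℕ := ⨅ z : ComplexDual L, kroneckerDimAt z

/-- Real algebraic subsets of a finite-dimensional real vector space: the common zero sets of
families of real polynomials in the linear coordinates. -/
def IsRealAlgebraic {V : Type*} [AddCommGroup V] [Module ℝ V] (S : Set V) : Prop :=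
  ∃ P : Set (MvPolynomial (Module.Dual ℝ V) ℝ),
    S = {x | ∀ p ∈ P, MvPolynomial.eval (fun ℓ : Module.Dual ℝ V => ℓ x) p = 0}

/-- The property that characterizes the Kronecker irregularity set as the least set having it:
`S` is real algebraic, contains the incompleteness set, and `μ(z)` is constant and minimal outside
of `S`. -/
structure HasKroneckerProperty (S : Set (ComplexDual L)) : Prop where
  isRealAlgebraic : IsRealAlgebraic S
  incompletenessSet_subset : incompletenessSet L ⊆ S
  eq_trivialKroneckerDim : ∀ z ∉ S, kroneckerDimAt z = trivialKroneckerDim L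

variable (L) in
/-- The Kronecker irregularity set: the least set with the property above. -/
def kroneckerIrregularitySet : Set (ComplexDual L) :=
  ⋂₀ {S | HasKroneckerProperty S}

variable (L) in
/-- The least set with the Kronecker property exists. -/
theorem isLeast_kroneckerIrregularitySet :
    IsLeast {S : Set (ComplexDual L) | HasKroneckerProperty S} (kroneckerIrregularitySet L) := by
  refine ⟨⟨?_, ?_, ?_⟩, fun S hS => Set.sInter_subset_of_mem hS⟩
  · refine ⟨{p | ∃ S : Set (ComplexDual L), HasKroneckerProperty S ∧
      ∀ x ∈ S, MvPolynomial.eval (fun ℓ : Module.Dual ℝ (ComplexDual L) => ℓ x) p = 0}, ?_⟩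
    ext x
    constructor
    · rintro hx p ⟨S, hS, hp⟩
      exact hp x (hx S hS)
    · intro hx S hS
      obtain ⟨P, hP⟩ := hS.isRealAlgebraic
      rw [hP]
      intro p hp
      refine hx p ⟨S, hS, fun y hy => ?_⟩
      rw [hP] at hy
      exact hy p hp
  · exact fun z hz S hS => hS.incompletenessSet_subset hz
  · intro z hz
    simp only [kroneckerIrregularitySet, Set.mem_sInter, not_forall] at hz
    obtain ⟨S, hS, hzS⟩ := hz
    exact hS.eq_trivialKroneckerDim z hzS

end Algebra

/-! ### The `(1,0)`-part of a real subspace of a complex vector space -/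

section CR

variable (V : Type*) [AddCommGroup V] [Module ℝ V] [Module ℂ V] [IsScalarTower ℝ ℂ V]

/-- The complex structure `J` (multiplication by `i`) of a complex vector space. -/
def complexStructure : V →ₗ[ℝ] V := (LinearMap.lsmul ℂ V Complex.I).restrictScalars ℝ

/-- The holomorphic tangent space `V^{1,0} ⊆ ℂ ⊗[ℝ] V`: the `i`-eigenspace of `J`. -/
def holomorphicTangent : Submodule ℂ (ℂ ⊗[ℝ] V) :=
  Module.End.eigenspace ((complexStructure V).baseChange ℂ) Complex.I

variable {V}

/-- `T^{1,0} = T^ℂ ∩ V^{1,0}` for a real subspace `T` of `V`. -/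
def holomorphicPart (T : Submodule ℝ V) : Submodule ℂ (ℂ ⊗[ℝ] V) :=
  T.baseChange ℂ ⊓ holomorphicTangent V

end CR

/-! ### Coadjoint orbits of a real Lie group in the complexified dual -/

section Orbits

/-- `minSmoothness ℝ 3`, the smoothness at which Mathlib defines the Lie algebra of a real Lie
group, equals `3`. -/
instance : ENat.LEInfty (minSmoothness ℝ 3) :=
  ⟨by rw [minSmoothness_of_isRCLikeNormedField]; exact ENat.LEInfty.out⟩

variable {E : Type*} [NormedAddCommGroup E] [NormedSpace ℝ E]
  {G : Type*} [TopologicalSpace G] [ChartedSpace E G] [Group G]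

/-- The adjoint action of `g` on the Lie algebra: the differential at `1` of the conjugation
`x ↦ g x g⁻¹` (which fixes `1`). -/
def adjointMap (g : G) : GroupLieAlgebra 𝓘(ℝ, E) G →L[ℝ] GroupLieAlgebra 𝓘(ℝ, E) G :=
  mfderiv 𝓘(ℝ, E) 𝓘(ℝ, E) (fun x : G => g * x * g⁻¹) 1

/-- The (right) action of `g ∈ G₀` on `𝔤^* = 𝔤₀^* + i 𝔤₀^*`: the coadjoint action on the real and on
the imaginary part. -/
def coadjointAct (z : ComplexDual (GroupLieAlgebra 𝓘(ℝ, E) G)) (g : G) :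
    ComplexDual (GroupLieAlgebra 𝓘(ℝ, E) G) :=
  z.comp (adjointMap g)

/-- The `G₀`-orbit through `z`. -/
def coadjointOrbit (z : ComplexDual (GroupLieAlgebra 𝓘(ℝ, E) G)) :
    Set (ComplexDual (GroupLieAlgebra 𝓘(ℝ, E) G)) :=
  Set.range (coadjointAct z)

/-- The orbit map `g ↦ z · g`. Its values lie in the dual of the Lie algebra, whose underlying
normed space is the model space `E`; this is how `𝔤^*` is viewed as a normed space. -/
def orbitMap (z : ComplexDual (GroupLieAlgebra 𝓘(ℝ, E) G)) : G → (E →L[ℝ] ℂ) :=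
  coadjointAct z

/-- The differential at `1` of the orbit map of `z`. -/
def orbitDifferential (z : ComplexDual (GroupLieAlgebra 𝓘(ℝ, E) G)) : E →L[ℝ] (E →L[ℝ] ℂ) :=
  mfderiv 𝓘(ℝ, E) 𝓘(ℝ, E →L[ℝ] ℂ) (orbitMap z) 1

/-- The tangent space `T_z O` at `z` of the orbit `O` of `z`, as an immersed submanifold of `𝔤^*`:
the image of the differential at `1` of the orbit map `g ↦ z · g`. -/
def orbitTangent (z : ComplexDual (GroupLieAlgebra 𝓘(ℝ, E) G)) : Submodule ℝ (E →L[ℝ] ℂ) :=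
  LinearMap.range (orbitDifferential z : E →ₗ[ℝ] (E →L[ℝ] ℂ))

end Orbits

end

/-! The differential at `1` of the orbit map of `z` is the real-linear map `D : v ↦ z ([v, ·])` from
𝔤₀ to 𝔤^*. The space `ℂ ⊗ 𝔤^*` splits into a (1,0)- and a (0,1)-component, each a copy of the dual
of 𝔤, and in this splitting the complexification of `D` is the pair (c(z), c̃(z)). Its kernel is
therefore ker c(z) ∩ ker c̃(z), of dimension μ off the irregularity set, and rank–nullity gives
(ii). The (1,0)-part of its range is the image of ker c̃(z), of dimension dim ker c̃(z) − μ. Since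
`z` is not in the incompleteness set, z̄ is regular, so dim ker c̃(z) = r, which is (i).

Two inputs remain. `orbitDifferential_apply` computes `D`: in a chart with product m, Ad satisfies
∂₁m(e, y) ∘ Ad y = ∂₂m(y, e), and its derivative at e is the antisymmetrized mixed second derivative
of m, which is also the bracket of left-invariant fields.

For semisimple 𝔤, `trivialKroneckerDim_eq_zero_of_isSemisimple` gives μ = 0. Two elements with
trivial common centralizer become, through the Killing form, two complex forms whose stabilizers
meet trivially. A pencil argument makes the forms real, say x and y, and then μ(x + iy) = 0. -/

/-! ### Base change and dimension counts. -/

section LinearAlgebra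

/-- The range of a base change is the base change of the range. -/
theorem LinearMap.range_baseChange_eq {R A M N : Type*} [CommRing R] [CommRing A] [Algebra R A]
    [AddCommGroup M] [Module R M] [AddCommGroup N] [Module R N] (f : M →ₗ[R] N) :
    LinearMap.range (f.baseChange A) = (LinearMap.range f).baseChange A := by
  have h : f.baseChange A =
      ((LinearMap.range f).subtype.baseChange A).comp (f.rangeRestrict.baseChange A) := by
    rw [← LinearMap.baseChange_comp]; rfl
  rw [h, LinearMap.range_comp_of_range_eq_top]
  · rfl
  · exact LinearMap.range_eq_top.mpr
      (LinearMap.lTensor_surjective A f.surjective_rangeRestrict)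

/-- Scalar extension to a larger field preserves the dimension of a subspace. -/
theorem Submodule.finrank_baseChange_eq {K F M : Type*} [Field K] [Field F] [Algebra K F]
    [AddCommGroup M] [Module K M] (p : Submodule K M) :
    Module.finrank F (p.baseChange F) = Module.finrank K p := by
  rw [← (Submodule.toBaseChange.toLinearEquiv F p).finrank_eq, Module.finrank_baseChange]

/-- Dimension count for the part of the range of `f` killed by `g`. -/
theorem LinearMap.finrank_range_inf_ker {K M N P : Type*} [Field K] [AddCommGroup M] [Module K M]
    [AddCommGroup N] [Module K N] [AddCommGroup P] [Module K P] [FiniteDimensional K M]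
    (f : M →ₗ[K] N) (g : N →ₗ[K] P) :
    Module.finrank K ↥(LinearMap.range f ⊓ LinearMap.ker g) + Module.finrank K (LinearMap.ker f) =
      Module.finrank K (LinearMap.ker (g.comp f)) := by
  -- Rank–nullity for `f` on `ker (g ∘ f)`: the image is `range f ∩ ker g`, and the kernel is all of
  -- `ker f`.
  have h := (f.domRestrict (LinearMap.ker (g.comp f))).finrank_range_add_finrank_ker
  have hker : LinearMap.ker f ≤ LinearMap.ker (g.comp f) := LinearMap.ker_le_ker_comp f g
  rw [← h, LinearMap.range_domRestrict, LinearMap.ker_comp, Submodule.map_comap_eq]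
  congr 1
  rw [LinearMap.domRestrict, LinearMap.ker_comp, ← LinearMap.ker_comp,
    ← (Submodule.comapSubtypeEquivOfLe hker).finrank_eq]

end LinearAlgebra

/-! ### The (1,0)- and (0,1)-components, and the two dimension formulas. -/

section ComplexDual

variable {L : Type*} [LieRing L] [LieAlgebra ℝ L] [TopologicalSpace L]

namespace ComplexDual

@[simp] theorem extend_tmul (z : ComplexDual L) (s : ℂ) (x : L) :
    z.extend (s ⊗ₜ[ℝ] x) = s * z x := by
  simp [extend]

@[simp] theorem conj_apply (z : ComplexDual L) (x : L) :
    z.conj x = (starRingEnd ℂ) (z x) := rfl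

@[simp] theorem conj_conj (z : ComplexDual L) : z.conj.conj = z := by
  ext x; simp

theorem conj_add (z w : ComplexDual L) : (z + w).conj = z.conj + w.conj := by
  ext x; simp

theorem conj_smul (s : ℂ) (z : ComplexDual L) :
    (s • z).conj = (starRingEnd ℂ) s • z.conj := by
  ext x; simp

theorem extend_add (z w : ComplexDual L) : (z + w).extend = z.extend + w.extend := by
  ext x; simp

theorem extend_smul (s : ℂ) (z : ComplexDual L) : (s • z).extend = s • z.extend := by
  ext x; simp

variable (L) in
/-- The `(1,0)`-component `s ⊗ z ↦ s z` of the complexified tangent space of `𝔤^*`. -/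
noncomputable def holomorphicComponent : ℂ ⊗[ℝ] ComplexDual L →ₗ[ℂ] Module.Dual ℂ (Complexified L) :=
  LinearMap.liftBaseChange ℂ
    { toFun := fun z => z.extend
      map_add' := extend_add
      map_smul' := fun r z => by ext x; simp }

variable (L) in
/-- The `(0,1)`-component `s ⊗ z ↦ s z̄` of the complexified tangent space of `𝔤^*`. -/
noncomputable def antiholomorphicComponent : ℂ ⊗[ℝ] ComplexDual L →ₗ[ℂ] Module.Dual ℂ (Complexified L) :=
  LinearMap.liftBaseChange ℂ
    { toFun := fun z => z.conj.extend
      map_add' := fun z w => by rw [conj_add, extend_add]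
      map_smul' := fun r z => by ext x; simp }

@[simp] theorem holomorphicComponent_tmul (s : ℂ) (z : ComplexDual L) :
    holomorphicComponent L (s ⊗ₜ z) = s • z.extend := by
  simp [holomorphicComponent]

@[simp] theorem antiholomorphicComponent_tmul (s : ℂ) (z : ComplexDual L) :
    antiholomorphicComponent L (s ⊗ₜ z) = s • z.conj.extend := by
  simp [antiholomorphicComponent]

theorem exists_eq_one_tmul_add_I_tmul {V : Type*} [AddCommGroup V] [Module ℝ V] (ξ : ℂ ⊗[ℝ] V) :
    ∃ z w : V, ξ = 1 ⊗ₜ z + Complex.I ⊗ₜ w := by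
  induction ξ with
  | zero => exact ⟨0, 0, by simp⟩
  | tmul s z =>
    refine ⟨s.re • z, s.im • z, ?_⟩
    rw [← TensorProduct.smul_tmul, ← TensorProduct.smul_tmul, ← TensorProduct.add_tmul]
    congr 1
    apply Complex.ext <;> simp
  | add ξ η hξ hη =>
    obtain ⟨z, w, rfl⟩ := hξ
    obtain ⟨z', w', rfl⟩ := hη
    refine ⟨z + z', w + w', ?_⟩
    rw [TensorProduct.tmul_add, TensorProduct.tmul_add]
    abel

/-- For ξ = 1 ⊗ z + i ⊗ w, the first component yields z + iw and the conjugate of the second yields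
z − iw; these determine z and w. -/
theorem eq_zero_of_components_eq_zero {ξ : ℂ ⊗[ℝ] ComplexDual L}
    (h : holomorphicComponent L ξ = 0) (h' : antiholomorphicComponent L ξ = 0) : ξ = 0 := by
  obtain ⟨z, w, rfl⟩ := exists_eq_one_tmul_add_I_tmul ξ
  have hz (x : L) : z x + Complex.I * w x = 0 := by
    simpa using LinearMap.congr_fun h (1 ⊗ₜ[ℝ] x)
  have hw (x : L) : z x - Complex.I * w x = 0 := by
    simpa [sub_eq_add_neg] using
      congrArg (starRingEnd ℂ) (LinearMap.congr_fun h' (1 ⊗ₜ[ℝ] x))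
  have z0 : z = 0 := by
    ext x
    change z x = 0
    linear_combination (hz x + hw x) / 2
  subst z0
  have w0 : w = 0 := by
    ext x
    simpa using hz x
  simp [w0]

theorem holomorphicComponent_complexStructure (ξ : ℂ ⊗[ℝ] ComplexDual L) :
    holomorphicComponent L ((complexStructure (ComplexDual L)).baseChange ℂ ξ) =
      Complex.I • holomorphicComponent L ξ := by
  induction ξ with
  | zero => simp
  | tmul s z =>
    rw [LinearMap.baseChange_tmul, holomorphicComponent_tmul, holomorphicComponent_tmul]
    change s • (Complex.I • z).extend = _
    rw [extend_smul, smul_comm]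
  | add ξ η hξ hη => simp only [map_add, hξ, hη, smul_add]

theorem antiholomorphicComponent_complexStructure (ξ : ℂ ⊗[ℝ] ComplexDual L) :
    antiholomorphicComponent L ((complexStructure (ComplexDual L)).baseChange ℂ ξ) =
      -(Complex.I • antiholomorphicComponent L ξ) := by
  induction ξ with
  | zero => simp
  | tmul s z =>
    rw [LinearMap.baseChange_tmul, antiholomorphicComponent_tmul, antiholomorphicComponent_tmul]
    change s • (Complex.I • z).conj.extend = _
    rw [conj_smul, extend_smul, smul_comm, Complex.conj_I, neg_smul]
  | add ξ η hξ hη => simp only [map_add, hξ, hη, smul_add, neg_add]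

/-- J acts as i on the first component and as −i on the second, so the i-eigenspace is cut out by
the vanishing of the second. This turns the (1,0)-part of a range into a range intersected with a
kernel. -/
theorem holomorphicTangent_eq_ker :
    holomorphicTangent (ComplexDual L) = LinearMap.ker (antiholomorphicComponent L) := by
  ext ξ
  rw [holomorphicTangent, Module.End.mem_eigenspace_iff, LinearMap.mem_ker]
  constructor
  · intro h
    have h' := antiholomorphicComponent_complexStructure ξ
    rw [h, map_smul, eq_neg_iff_add_eq_zero, ← add_smul] at h'
    refine (smul_eq_zero.mp h').resolve_left ?_
    simp [← two_mul]
  · intro h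
    rw [← sub_eq_zero]
    apply eq_zero_of_components_eq_zero
    · rw [map_sub, holomorphicComponent_complexStructure, map_smul, sub_self]
    · rw [map_sub, antiholomorphicComponent_complexStructure, map_smul, h]
      simp

end ComplexDual

theorem linearBivector_tmul_tmul (z : ComplexDual L) (s t : ℂ) (v w : L) :
    linearBivector z (s ⊗ₜ v) (t ⊗ₜ w) = s * t * z ⁅v, w⁆ := by
  simp [linearBivector]

theorem linearBivector_add (z w : ComplexDual L) :
    linearBivector (z + w) = linearBivector z + linearBivector w := by
  ext u v; simp [linearBivector_tmul_tmul]

theorem linearBivector_smul (s : ℂ) (z : ComplexDual L) :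
    linearBivector (s • z) = s • linearBivector z := by
  ext u v; simp [linearBivector_tmul_tmul]

variable {z : ComplexDual L} {D : L →ₗ[ℝ] ComplexDual L}

/-- `D` stands for the orbit differential; `hD` is the only fact about it that the linear algebra
needs. -/
theorem holomorphicComponent_comp_baseChange (hD : ∀ v w, D v w = z ⁅v, w⁆) :
    (ComplexDual.holomorphicComponent L).comp (D.baseChange ℂ) = linearBivector z := by
  ext v w
  simp [hD, linearBivector_tmul_tmul]

theorem antiholomorphicComponent_comp_baseChange (hD : ∀ v w, D v w = z ⁅v, w⁆) :
    (ComplexDual.antiholomorphicComponent L).comp (D.baseChange ℂ) = conjBivector z := by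
  ext v w
  simp [hD, linearBivector_tmul_tmul, conjBivector]

theorem ker_baseChange_eq (hD : ∀ v w, D v w = z ⁅v, w⁆) :
    LinearMap.ker (D.baseChange ℂ) =
      LinearMap.ker (linearBivector z) ⊓ LinearMap.ker (conjBivector z) := by
  rw [← holomorphicComponent_comp_baseChange hD, ← antiholomorphicComponent_comp_baseChange hD]
  refine le_antisymm (le_inf (LinearMap.ker_le_ker_comp _ _) (LinearMap.ker_le_ker_comp _ _)) ?_
  rintro u ⟨h, h'⟩
  exact ComplexDual.eq_zero_of_components_eq_zero h h'

variable [FiniteDimensional ℝ L]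

theorem bivectorRank_le (z : ComplexDual L) :
    bivectorRank z ≤ Module.finrank ℂ (Complexified L) :=
  LinearMap.finrank_range_le _

theorem bivectorRank_le_maxBivectorRank (z : ComplexDual L) :
    bivectorRank z ≤ maxBivectorRank L :=
  le_ciSup ⟨_, Set.forall_mem_range.mpr bivectorRank_le⟩ z

theorem bivectorRank_conj_of_notMem_kroneckerIrregularitySet
    (hz : z ∉ kroneckerIrregularitySet L) : bivectorRank z.conj = maxBivectorRank L := by
  have h : z ∉ incompletenessSet L := fun h =>
    hz ((isLeast_kroneckerIrregularitySet L).1.incompletenessSet_subset h)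
  refine le_antisymm (bivectorRank_le_maxBivectorRank _) (not_lt.mp fun hlt => h ?_)
  -- The combination with coefficients (0, 1) is z̄ itself, so a singular z̄ would put z in the
  -- incompleteness set.
  have h01 : (0 : ℂ) • z + (1 : ℂ) • z.conj = z.conj := by ext x; simp
  exact ⟨0, 1, by simp, by rwa [h01]⟩

/-- The real dimension of the image of `v ↦ z ([v, ·])`. -/
theorem finrank_range_add_trivialKroneckerDim (hD : ∀ v w, D v w = z ⁅v, w⁆)
    (hz : z ∉ kroneckerIrregularitySet L) :
    Module.finrank ℝ (LinearMap.range D) + trivialKroneckerDim L =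
      Module.finrank ℂ (Complexified L) := by
  rw [← (isLeast_kroneckerIrregularitySet L).1.eq_trivialKroneckerDim z hz, kroneckerDimAt,
    ← ker_baseChange_eq hD, ← Submodule.finrank_baseChange_eq (F := ℂ),
    ← LinearMap.range_baseChange_eq, LinearMap.finrank_range_add_finrank_ker]

/-- The complex dimension of the holomorphic part of the image of `v ↦ z ([v, ·])`. -/
theorem finrank_holomorphicPart_add_trivialKroneckerDim (hD : ∀ v w, D v w = z ⁅v, w⁆)
    (hz : z ∉ kroneckerIrregularitySet L) :
    Module.finrank ℂ (holomorphicPart (LinearMap.range D)) + trivialKroneckerDim L =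
      algebraRank L := by
  rw [← (isLeast_kroneckerIrregularitySet L).1.eq_trivialKroneckerDim z hz, kroneckerDimAt,
    ← ker_baseChange_eq hD, holomorphicPart, ← LinearMap.range_baseChange_eq,
    ComplexDual.holomorphicTangent_eq_ker, LinearMap.finrank_range_inf_ker,
    antiholomorphicComponent_comp_baseChange hD, algebraRank,
    ← bivectorRank_conj_of_notMem_kroneckerIrregularitySet hz, bivectorRank, conjBivector]
  have := (linearBivector z.conj).finrank_range_add_finrank_ker
  rw [← this, Nat.add_sub_cancel_left]

end ComplexDual

/-! ### Vanishing of μ for semisimple Lie algebras. -/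

section Semisimple

open LieAlgebra LieModule

/-- A Lie algebra with nondegenerate Killing form over an algebraically closed field contains two
elements with trivial common centralizer. -/
theorem LieAlgebra.IsKilling.exists_pair_centralizer_eq_bot (K 𝔤 : Type*) [Field K] [CharZero K]
    [IsAlgClosed K] [LieRing 𝔤] [LieAlgebra K 𝔤] [FiniteDimensional K 𝔤] [IsKilling K 𝔤] :
    ∃ A B : 𝔤, ∀ x : 𝔤, ⁅A, x⁆ = 0 → ⁅B, x⁆ = 0 → x = 0 := by
  obtain ⟨A, hA⟩ := exists_isCartanSubalgebra_engel K 𝔤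
  set H := LieSubalgebra.engel K A
  have hex (α : Weight K H 𝔤) : ∃ e ∈ rootSpace H α, e ≠ 0 := α.exists_ne_zero
  choose e he he0 using hex
  refine ⟨A, ∑ α, e α, fun x hAx hBx => ?_⟩
  -- The Engel subalgebra of `A`, here a Cartan subalgebra, contains the centralizer of `A`.
  have hx : x ∈ H := by
    rw [LieSubalgebra.mem_engel_iff]
    exact ⟨1, by simpa using hAx⟩
  have hli : LinearIndependent K e :=
    
    ((LieSubmodule.iSupIndep_toSubmodule.mpr
      (iSupIndep_genWeightSpace' K H 𝔤))).linearIndependent _ he he0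
  -- Weight spaces are true eigenspaces of H, so [x, B] = ∑ α(x) e_α. By independence every α(x)
  -- vanishes, and the weights have no common zero in H but 0.
  have hsum : ∑ α, α ⟨x, hx⟩ • e α = 0 := by
    rw [← lie_skew, neg_eq_zero, lie_sum] at hBx
    rw [← hBx]
    exact Finset.sum_congr rfl fun α _ => (lie_eq_smul_of_mem_rootSpace (he α) ⟨x, hx⟩).symm
  have h0 := Fintype.linearIndependent_iff.mp hli _ hsum
  have hmem : (⟨x, hx⟩ : H) ∈ ⨅ α : Weight K H 𝔤, α.ker := by
    simp only [Submodule.mem_iInf]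
    exact fun α => h0 α
  rw [iInf_ker_weight_eq_bot] at hmem
  exact congrArg Subtype.val ((Submodule.mem_bot K).mp hmem)

/-- If a linear pencil `P + t Q` of linear maps is injective for some complex `t`, it is injective
for some real `t`. -/
theorem LinearMap.exists_real_injective_add_smul {M N : Type*} [AddCommGroup M] [Module ℂ M]
    [FiniteDimensional ℂ M] [AddCommGroup N] [Module ℂ N] (P Q : M →ₗ[ℂ] N)
    (h : Function.Injective (P + Complex.I • Q)) :
    ∃ t : ℝ, Function.Injective (P + (t : ℂ) • Q) := by
  obtain ⟨S, hS⟩ := (P + Complex.I • Q).exists_leftInverse_of_injective (LinearMap.ker_eq_bot.mpr h)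
  let F : Module.End ℂ M := S.comp Q
  -- If (P + tQ)x = 0 with x ≠ 0, applying `S` gives x + (t − i)Fx = 0, so −(t − i)⁻¹ is an
  -- eigenvalue of `F`. Only finitely many real t allow this.
  have hfin : Set.Finite {t : ℝ | F.HasEigenvalue (-((t : ℂ) - Complex.I)⁻¹)} := by
    refine (F.finite_hasEigenvalue).preimage (f := fun t : ℝ => -((t : ℂ) - Complex.I)⁻¹) ?_
    intro s _ t _ hst
    simpa using hst
  obtain ⟨t, ht⟩ := hfin.exists_notMem
  refine ⟨t, LinearMap.ker_eq_bot.mp ((Submodule.eq_bot_iff _).mpr fun x hx => ?_)⟩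
  by_contra hx0
  apply ht
  have htI : (t : ℂ) - Complex.I ≠ 0 := fun h0 => by
    simpa using congrArg Complex.im h0
  have hSx : x + ((t : ℂ) - Complex.I) • F x = 0 := by
    have h1 : S ((P + (t : ℂ) • Q) x) = 0 := by rw [LinearMap.mem_ker.mp hx, map_zero]
    have h2 : S ((P + Complex.I • Q) x) = x := LinearMap.congr_fun hS x
    have h3 : (P + (t : ℂ) • Q) x = (P + Complex.I • Q) x + ((t : ℂ) - Complex.I) • Q x := by
      simp only [LinearMap.add_apply, LinearMap.smul_apply, sub_smul]
      abel
    rw [h3, map_add, h2, map_smul] at h1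
    exact h1
  refine Module.End.hasEigenvalue_of_hasEigenvector (x := x)
    ⟨Module.End.mem_eigenspace_iff.mpr ?_, hx0⟩
  rw [neg_smul, eq_neg_iff_add_eq_zero, ← smul_right_injective _ htI |>.eq_iff, smul_add,
    smul_inv_smul₀ htI, smul_zero, add_comm]
  exact hSx

/-- The splitting of a point of the complex dual into its real and imaginary parts. -/
theorem ComplexDual.exists_real_add_I_smul {L : Type*} [LieRing L] [LieAlgebra ℝ L]
    [TopologicalSpace L] (z : ComplexDual L) :
    ∃ a b : ComplexDual L, a.conj = a ∧ b.conj = b ∧ z = a + Complex.I • b := by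
  refine ⟨(2⁻¹ : ℂ) • (z + z.conj), (-Complex.I * 2⁻¹ : ℂ) • (z + (-1 : ℂ) • z.conj), ?_, ?_, ?_⟩
  · ext x
    simp [map_ofNat, add_comm]
  · ext x
    simp [map_ofNat]
    ring
  · ext x
    simp only [add_apply, smul_apply, conj_apply,
      smul_eq_mul]
    linear_combination ((z x - (starRingEnd ℂ) (z x)) / 2) * Complex.I_mul_I

variable {L : Type*} [LieRing L] [LieAlgebra ℝ L] [TopologicalSpace L] [FiniteDimensional ℝ L]

/-- The trivial Kronecker dimension vanishes as soon as two points of the complex dual have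
stabilizers with trivial intersection. -/
theorem trivialKroneckerDim_eq_zero_of_pair (a b : ComplexDual L)
    (hab : ∀ u, linearBivector a u = 0 → linearBivector b u = 0 → u = 0) :
    trivialKroneckerDim L = 0 := by
  obtain ⟨a₁, a₂, ha₁, ha₂, rfl⟩ := a.exists_real_add_I_smul
  obtain ⟨b₁, b₂, hb₁, hb₂, rfl⟩ := b.exists_real_add_I_smul
  -- Replacing i by a real t in a = a₁ + i a₂ and b = b₁ + i b₂ yields real points whose stabilizers
  -- still meet trivially.
  obtain ⟨t, ht⟩ := LinearMap.exists_real_injective_add_smul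
    ((linearBivector a₁).prod (linearBivector b₁)) ((linearBivector a₂).prod (linearBivector b₂)) <| by
      refine LinearMap.ker_eq_bot.mp ((Submodule.eq_bot_iff _).mpr fun u hu => ?_)
      have h := Prod.ext_iff.mp (LinearMap.mem_ker.mp hu)
      refine hab u ?_ ?_
      · rw [linearBivector_add, linearBivector_smul]
        exact h.1
      · rw [linearBivector_add, linearBivector_smul]
        exact h.2
  let x : ComplexDual L := a₁ + (t : ℂ) • a₂
  let y : ComplexDual L := b₁ + (t : ℂ) • b₂
  have hx : x.conj = x := by
    simp only [x, ComplexDual.conj_add, ComplexDual.conj_smul, ha₁, ha₂, Complex.conj_ofReal]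
  have hy : y.conj = y := by
    simp only [y, ComplexDual.conj_add, ComplexDual.conj_smul, hb₁, hb₂, Complex.conj_ofReal]
  -- As x and y are real, c(x + iy) and c(x − iy) have common kernel ker c(x) ∩ ker c(y).
  refine Nat.le_zero.mp ((ciInf_le (OrderBot.bddBelow _) (x + Complex.I • y)).trans ?_)
  rw [kroneckerDimAt, Nat.le_zero, Submodule.finrank_eq_zero, Submodule.eq_bot_iff]
  rintro u ⟨h, h'⟩
  replace h := LinearMap.mem_ker.mp h
  replace h' := LinearMap.mem_ker.mp h'
  rw [linearBivector_add, linearBivector_smul] at h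
  rw [conjBivector, ComplexDual.conj_add, ComplexDual.conj_smul, hx, hy, linearBivector_add,
    linearBivector_smul, Complex.conj_I] at h'
  simp only [LinearMap.add_apply, LinearMap.smul_apply, neg_smul] at h h'
  have hxu : linearBivector x u = 0 := by
    ext w
    have e := congrArg (fun f => f (1 ⊗ₜ[ℝ] w)) h
    have e' := congrArg (fun f => f (1 ⊗ₜ[ℝ] w)) h'
    simp only [LinearMap.add_apply, LinearMap.smul_apply, LinearMap.neg_apply,
      LinearMap.zero_apply] at e e'
    change linearBivector x u (1 ⊗ₜ[ℝ] w) = 0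
    linear_combination (e + e') / 2
  have hyu : linearBivector y u = 0 := by simpa [hxu] using h
  apply ht
  rw [map_zero]
  refine Prod.ext ?_ ?_
  · simpa [x, linearBivector_add, linearBivector_smul] using hxu
  · simpa [y, linearBivector_add, linearBivector_smul] using hyu

variable [IsTopologicalAddGroup L] [ContinuousSMul ℝ L] [T2Space L]

/-- Every complex form on the complexification comes from a point of the complex dual. -/
theorem ComplexDual.exists_extend_eq (f : Module.Dual ℂ (Complexified L)) :
    ∃ z : ComplexDual L, z.extend = f := by
  refine ⟨LinearMap.toContinuousLinearMap
    ((f.restrictScalars ℝ).comp (TensorProduct.mk ℝ ℂ L 1)), ?_⟩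
  ext x
  simp

/-- The trivial Kronecker dimension of a semisimple Lie algebra vanishes. -/
theorem trivialKroneckerDim_eq_zero_of_isSemisimple [IsSemisimple ℂ (Complexified L)] :
    trivialKroneckerDim L = 0 := by
  obtain ⟨A, B, hAB⟩ := IsKilling.exists_pair_centralizer_eq_bot ℂ (Complexified L)
  obtain ⟨a, ha⟩ := ComplexDual.exists_extend_eq (killingForm ℂ (Complexified L) A)
  obtain ⟨b, hb⟩ := ComplexDual.exists_extend_eq (killingForm ℂ (Complexified L) B)
  have key (C : Complexified L) (c : ComplexDual L)
      (hc : c.extend = killingForm ℂ (Complexified L) C) (u : Complexified L)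
      (hu : linearBivector c u = 0) : ⁅C, u⁆ = 0 := by
    -- Invariance: κ([C, u], w) = κ(C, [u, w]) = c([u, w]), which is zero for all w.
    refine (IsKilling.killingForm_nondegenerate ℂ (Complexified L)).1 _ fun w => ?_
    rw [LieModule.traceForm_apply_lie_apply, ← hc]
    exact LinearMap.congr_fun hu w
  exact trivialKroneckerDim_eq_zero_of_pair a b fun u h h' => hAB u (key A a ha u h) (key B b hb u h')

end Semisimple

/-! ### Derivative of Ad for a local product. -/

section LocalProduct

open Filter Topology

variable {E : Type*} [NormedAddCommGroup E] [NormedSpace ℝ E]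

/-- Logarithmic differentiation of the solution of `B y * X y = A y` at a point where `A` and `B`
take the value `1`. -/
theorem hasFDerivAt_of_mul_eq {R : Type*} [NormedRing R] [NormedAlgebra ℝ R]
    [HasSummableGeomSeries R] {A B X : E → R} {A' B' : E →L[ℝ] R} {e : E} (hB : HasFDerivAt B B' e)
    (hA : HasFDerivAt A A' e) (hBe : B e = 1) (hAe : A e = 1)
    (hX : ∀ᶠ y in 𝓝 e, B y * X y = A y) : HasFDerivAt X (A' - B') e := by
  have hI : HasFDerivAt (fun y => Ring.inverse (B y)) (-B') e := by
    have h1 := hasFDerivAt_ringInverse (𝕜 := ℝ) (1 : Rˣ)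
    rw [Units.val_one, ← hBe] at h1
    refine (h1.comp e hB).congr_fderiv ?_
    ext v
    simp
  have hunit : ∀ᶠ y in 𝓝 e, IsUnit (B y) := by
    have : ∀ᶠ T in 𝓝 (B e), IsUnit T := by
      rw [hBe]; exact Units.isOpen.mem_nhds isUnit_one
    exact hB.continuousAt.eventually this
  have hXE : X =ᶠ[𝓝 e] fun y => Ring.inverse (B y) * A y := by
    filter_upwards [hX, hunit] with y hy hu
    rw [← hy, ← mul_assoc, Ring.inverse_mul_cancel _ hu, one_mul]
  refine ((hI.mul' hA).congr_of_eventuallyEq hXE).congr_fderiv ?_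
  ext v
  simp [hBe, hAe, sub_eq_add_neg]

/-- If `m` is a `C²` local product with neutral element `e`, and `Ad y` is given by
`∂₁ m (e, y) ∘ Ad y = ∂₂ m (y, e)`, then the derivative of `Ad` at `e` is the antisymmetrization of
the mixed second derivative of `m` at `(e, e)`. -/
theorem exists_hasFDerivAt_of_local_product [CompleteSpace E] {m : E × E → E} {e : E}
    (hm : ContDiffAt ℝ 2 m (e, e)) (hl : ∀ᶠ x in 𝓝 e, m (x, e) = x)
    (hr : ∀ᶠ x in 𝓝 e, m (e, x) = x) {Ad : E → E →L[ℝ] E}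
    (hAd : ∀ᶠ y in 𝓝 e, (fderiv ℝ m (e, y) ∘L .inl ℝ E E) ∘L Ad y =
      fderiv ℝ m (y, e) ∘L .inr ℝ E E) :
    ∃ F : E →L[ℝ] E →L[ℝ] E, HasFDerivAt Ad F e ∧ ∀ v w, F v w =
      fderiv ℝ (fderiv ℝ m) (e, e) (v, 0) (0, w) - fderiv ℝ (fderiv ℝ m) (e, e) (w, 0) (0, v) := by
  have hsymm : IsSymmSndFDerivAt ℝ m (e, e) := hm.isSymmSndFDerivAt (by simp)
  have hd2 : HasFDerivAt (fderiv ℝ m) (fderiv ℝ (fderiv ℝ m) (e, e)) (e, e) :=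
    ((hm.fderiv_right (m := 1) (by norm_num)).differentiableAt (by simp)).hasFDerivAt
  have hd1 : HasFDerivAt m (fderiv ℝ m (e, e)) (e, e) :=
    (hm.differentiableAt (by simp)).hasFDerivAt
  have hB0 : fderiv ℝ m (e, e) ∘L .inl ℝ E E = .id ℝ E :=
    (hd1.comp (f := fun x : E => (x, e)) e (hasFDerivAt_prodMk_left e e)).unique
      ((hasFDerivAt_id e).congr_of_eventuallyEq hl)
  have hA0 : fderiv ℝ m (e, e) ∘L .inr ℝ E E = .id ℝ E :=
    (hd1.comp (f := fun x : E => (e, x)) e (hasFDerivAt_prodMk_right e e)).unique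
      ((hasFDerivAt_id e).congr_of_eventuallyEq hr)
  let PL : ((E × E) →L[ℝ] E) →L[ℝ] (E →L[ℝ] E) :=
    (ContinuousLinearMap.compL ℝ E (E × E) E).flip (.inl ℝ E E)
  let PR : ((E × E) →L[ℝ] E) →L[ℝ] (E →L[ℝ] E) :=
    (ContinuousLinearMap.compL ℝ E (E × E) E).flip (.inr ℝ E E)
  let A : E → E →L[ℝ] E := fun y => PR (fderiv ℝ m (y, e))
  let B : E → E →L[ℝ] E := fun y => PL (fderiv ℝ m (e, y))
  have hA : HasFDerivAt A (PR ∘L (fderiv ℝ (fderiv ℝ m) (e, e) ∘L .inl ℝ E E)) e :=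
    PR.hasFDerivAt.comp e
      (hd2.comp (f := fun x : E => (x, e)) e (hasFDerivAt_prodMk_left e e))
  have hB : HasFDerivAt B (PL ∘L (fderiv ℝ (fderiv ℝ m) (e, e) ∘L .inr ℝ E E)) e :=
    PL.hasFDerivAt.comp e
      (hd2.comp (f := fun x : E => (e, x)) e (hasFDerivAt_prodMk_right e e))
  refine ⟨_, hasFDerivAt_of_mul_eq hB hA hB0 hA0 hAd, fun v w => ?_⟩
  -- The derivative of `B` has its direction in the second factor; symmetry brings it to the same
  -- mixed form as that of `A`.
  have hs : fderiv ℝ (fderiv ℝ m) (e, e) (0, v) (w, 0) =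
    fderiv ℝ (fderiv ℝ m) (e, e) (w, 0) (0, v) := hsymm _ _
  simp [PL, PR, hs]

end LocalProduct

/-! ### Multiplication, conjugation and left-invariant fields in the chart at 1. -/

section LieGroup

open Filter Topology VectorField

variable {E : Type*} [NormedAddCommGroup E] [NormedSpace ℝ E]

/-- On a boundaryless manifold modelled on a normed space, the manifold derivative is the derivative
of the map read in the preferred charts. -/
theorem MDifferentiableAt.mfderiv_eq_fderiv {F M N : Type*} [NormedAddCommGroup F]
    [NormedSpace ℝ F] [TopologicalSpace M] [ChartedSpace E M] [TopologicalSpace N]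
    [ChartedSpace F N] {f : M → N} {x : M} (hf : MDifferentiableAt 𝓘(ℝ, E) 𝓘(ℝ, F) f x) :
    (mfderiv 𝓘(ℝ, E) 𝓘(ℝ, F) f x : E →L[ℝ] F) =
      fderiv ℝ (writtenInExtChartAt 𝓘(ℝ, E) 𝓘(ℝ, F) x f) (extChartAt 𝓘(ℝ, E) x x) := by
  rw [hf.mfderiv, modelWithCornersSelf_coe, Set.range_id, fderivWithin_univ]

/-- The differentiability statement that goes with `MDifferentiableAt.mfderiv_eq_fderiv`. -/
theorem MDifferentiableAt.differentiableAt_writtenInExtChartAt {F M N : Type*}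
    [NormedAddCommGroup F] [NormedSpace ℝ F] [TopologicalSpace M] [ChartedSpace E M]
    [TopologicalSpace N] [ChartedSpace F N] {f : M → N} {x : M}
    (hf : MDifferentiableAt 𝓘(ℝ, E) 𝓘(ℝ, F) f x) :
    DifferentiableAt ℝ (writtenInExtChartAt 𝓘(ℝ, E) 𝓘(ℝ, F) x f) (extChartAt 𝓘(ℝ, E) x x) := by
  have h := ((mdifferentiableAt_iff _ _).mp hf).2
  rwa [modelWithCornersSelf_coe, Set.range_id, differentiableWithinAt_univ] at h

variable {G : Type*} [TopologicalSpace G] [ChartedSpace E G] [Group G]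

variable (E G) in
/-- The group multiplication in the preferred chart at `1`. -/
noncomputable def chartMul (p : E × E) : E :=
  extChartAt 𝓘(ℝ, E) (1 : G)
    ((extChartAt 𝓘(ℝ, E) (1 : G)).symm p.1 * (extChartAt 𝓘(ℝ, E) (1 : G)).symm p.2)

variable (E G) in
/-- The coordinates of `1` in the preferred chart at `1`. -/
noncomputable def chartOne : E := extChartAt 𝓘(ℝ, E) (1 : G) 1

@[simp] theorem extChartAt_symm_chartOne :
    (extChartAt 𝓘(ℝ, E) (1 : G)).symm (chartOne E G) = 1 :=
  extChartAt_to_inv 1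

theorem extChartAt_target_mem_nhds_chartOne :
    (extChartAt 𝓘(ℝ, E) (1 : G)).target ∈ 𝓝 (chartOne E G) :=
  extChartAt_target_mem_nhds 1

theorem eventually_chartMul_chartOne_right :
    ∀ᶠ x in 𝓝 (chartOne E G), chartMul E G (x, chartOne E G) = x := by
  filter_upwards [extChartAt_target_mem_nhds_chartOne] with x hx
  rw [chartMul, extChartAt_symm_chartOne, mul_one, (extChartAt 𝓘(ℝ, E) (1 : G)).right_inv hx]

theorem eventually_chartMul_chartOne_left :
    ∀ᶠ x in 𝓝 (chartOne E G), chartMul E G (chartOne E G, x) = x := by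
  filter_upwards [extChartAt_target_mem_nhds_chartOne] with x hx
  rw [chartMul, extChartAt_symm_chartOne, one_mul, (extChartAt 𝓘(ℝ, E) (1 : G)).right_inv hx]

variable [LieGroup 𝓘(ℝ, E) ∞ G]

theorem contMDiffAt_extChartAt_symm_of_mem_target {x : E}
    (hx : x ∈ (extChartAt 𝓘(ℝ, E) (1 : G)).target) :
    ContMDiffAt 𝓘(ℝ, E) 𝓘(ℝ, E) ∞ (extChartAt 𝓘(ℝ, E) (1 : G)).symm x :=
  (contMDiffOn_extChartAt_symm 1).contMDiffAt ((isOpen_extChartAt_target 1).mem_nhds hx)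

/-- The product in the chart is smooth at every pair of coordinates whose product lies in the
chart. -/
theorem contDiffAt_chartMul {x y : E} (hx : x ∈ (extChartAt 𝓘(ℝ, E) (1 : G)).target)
    (hy : y ∈ (extChartAt 𝓘(ℝ, E) (1 : G)).target)
    (hxy : (extChartAt 𝓘(ℝ, E) (1 : G)).symm x * (extChartAt 𝓘(ℝ, E) (1 : G)).symm y ∈
      (extChartAt 𝓘(ℝ, E) (1 : G)).source) :
    ContDiffAt ℝ ∞ (chartMul E G) (x, y) := by
  rw [← contMDiffAt_iff_contDiffAt]
  have h1 : ContMDiffAt 𝓘(ℝ, E × E) 𝓘(ℝ, E) ∞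
      (fun p : E × E => (extChartAt 𝓘(ℝ, E) (1 : G)).symm p.1) (x, y) :=
    (contMDiffAt_extChartAt_symm_of_mem_target hx).comp (x, y) contDiff_fst.contMDiff.contMDiffAt
  have h2 : ContMDiffAt 𝓘(ℝ, E × E) 𝓘(ℝ, E) ∞
      (fun p : E × E => (extChartAt 𝓘(ℝ, E) (1 : G)).symm p.2) (x, y) :=
    (contMDiffAt_extChartAt_symm_of_mem_target hy).comp (x, y) contDiff_snd.contMDiff.contMDiffAt
  exact (contMDiffAt_extChartAt' (extChartAt_source 𝓘(ℝ, E) (1 : G) ▸ hxy)).comp (x, y) (h1.mul h2)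

theorem contDiffAt_chartMul_chartOne : ContDiffAt ℝ ∞ (chartMul E G) (chartOne E G, chartOne E G) := by
  have h := mem_of_mem_nhds (extChartAt_target_mem_nhds_chartOne (E := E) (G := G))
  refine contDiffAt_chartMul h h ?_
  rw [extChartAt_symm_chartOne, one_mul]
  exact mem_extChartAt_source 1

theorem differentiableAt_chartMul_left {x : E} (hx : x ∈ (extChartAt 𝓘(ℝ, E) (1 : G)).target) :
    DifferentiableAt ℝ (chartMul E G) (x, chartOne E G) := by
  refine (contDiffAt_chartMul hx (mem_of_mem_nhds extChartAt_target_mem_nhds_chartOne)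
    ?_).differentiableAt (by simp)
  rw [extChartAt_symm_chartOne, mul_one]
  exact (extChartAt 𝓘(ℝ, E) (1 : G)).map_target hx

theorem differentiableAt_chartMul_right {x : E} (hx : x ∈ (extChartAt 𝓘(ℝ, E) (1 : G)).target) :
    DifferentiableAt ℝ (chartMul E G) (chartOne E G, x) := by
  refine (contDiffAt_chartMul (mem_of_mem_nhds extChartAt_target_mem_nhds_chartOne) hx
    ?_).differentiableAt (by simp)
  rw [extChartAt_symm_chartOne, one_mul]
  exact (extChartAt 𝓘(ℝ, E) (1 : G)).map_target hx

theorem mdifferentiableAt_conj (g : G) :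
    MDifferentiableAt 𝓘(ℝ, E) 𝓘(ℝ, E) (fun x : G => g * x * g⁻¹) 1 :=
  (((contMDiff_mul_left (I := 𝓘(ℝ, E)) (n := ∞) (a := g)).mul contMDiff_const).contMDiffAt
    ).mdifferentiableAt (by simp)

theorem mdifferentiableAt_leftMul_one (g : G) :
    MDifferentiableAt 𝓘(ℝ, E) 𝓘(ℝ, E) (g * ·) (1 : G) :=
  (contMDiff_mul_left (I := 𝓘(ℝ, E)) (n := ∞) (a := g)).contMDiffAt.mdifferentiableAt (by simp)

variable (E) in
/-- The adjoint action, as an endomorphism of the model space. -/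
noncomputable def adjointEnd (g : G) : E →L[ℝ] E := adjointMap (E := E) g

theorem hasFDerivAt_conj (g : G) :
    HasFDerivAt (fun x : E => extChartAt 𝓘(ℝ, E) (1 : G)
      (g * (extChartAt 𝓘(ℝ, E) (1 : G)).symm x * g⁻¹)) (adjointEnd E g) (chartOne E G) := by
  have h := (mdifferentiableAt_conj (E := E) g).differentiableAt_writtenInExtChartAt.hasFDerivAt
  rw [← (mdifferentiableAt_conj (E := E) g).mfderiv_eq_fderiv] at h
  -- The target chart is the one at g · 1 · g⁻¹, which simplifies to the chart at 1.
  have hw : writtenInExtChartAt 𝓘(ℝ, E) 𝓘(ℝ, E) (1 : G) (fun x : G => g * x * g⁻¹) =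
      fun x : E => extChartAt 𝓘(ℝ, E) (1 : G)
        (g * (extChartAt 𝓘(ℝ, E) (1 : G)).symm x * g⁻¹) := by
    ext x
    simp [writtenInExtChartAt]
  rw [hw] at h
  exact h

/-- The relation `(g x g⁻¹) g = g x` differentiated in `x` at `1`. -/
theorem fderiv_chartMul_comp_adjointEnd {y : E}
    (hy : y ∈ (extChartAt 𝓘(ℝ, E) (1 : G)).target) :
    (fderiv ℝ (chartMul E G) (chartOne E G, y) ∘L .inl ℝ E E) ∘L
        adjointEnd E ((extChartAt 𝓘(ℝ, E) (1 : G)).symm y) =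
      fderiv ℝ (chartMul E G) (y, chartOne E G) ∘L .inr ℝ E E := by
  set φ := extChartAt 𝓘(ℝ, E) (1 : G)
  set g : G := φ.symm y
  have hk := hasFDerivAt_conj (E := E) g
  have hk1 : φ (g * φ.symm (chartOne E G) * g⁻¹) = chartOne E G := by
    rw [extChartAt_symm_chartOne, mul_one, mul_inv_cancel]; rfl
  have hr := (differentiableAt_chartMul_left hy).hasFDerivAt.comp
    (f := fun x : E => (y, x)) (chartOne E G) (hasFDerivAt_prodMk_right y (chartOne E G))
  have hl' : HasFDerivAt (chartMul E G ∘ fun x : E => (x, y))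
      (fderiv ℝ (chartMul E G) (chartOne E G, y) ∘L .inl ℝ E E) (chartOne E G) :=
    (differentiableAt_chartMul_right hy).hasFDerivAt.comp
      (f := fun x : E => (x, y)) (chartOne E G) (hasFDerivAt_prodMk_left (chartOne E G) y)
  -- The chain rule wants the outer derivative at the image point, which equals `chartOne` only
  -- propositionally.
  rw [← hk1] at hl'
  have hl := hl'.comp (chartOne E G) hk
  rw [hk1] at hl
  refine hl.unique (hr.congr_of_eventuallyEq ?_)
  have hev : ∀ᶠ x in 𝓝 (chartOne E G), g * φ.symm x * g⁻¹ ∈ φ.source := by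
    have hc : ContinuousAt (fun x => g * φ.symm x * g⁻¹) (chartOne E G) := by
      have : ContinuousMul G := continuousMul_of_contMDiffMul 𝓘(ℝ, E) ∞
      exact (continuousAt_const.mul (continuousAt_extChartAt_symm 1)).mul continuousAt_const
    apply hc.eventually
    change ∀ᶠ x in 𝓝 (g * φ.symm (chartOne E G) * g⁻¹), _
    rw [extChartAt_symm_chartOne, mul_one, mul_inv_cancel]
    exact extChartAt_source_mem_nhds 1
  filter_upwards [hev] with x hx
  simp only [Function.comp_apply, chartMul]
  rw [show (extChartAt 𝓘(ℝ, E) (1 : G)).symm (extChartAt 𝓘(ℝ, E) (1 : G)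
    (g * (extChartAt 𝓘(ℝ, E) (1 : G)).symm x * g⁻¹)) = _ from φ.left_inv hx]
  simp [g, φ]

/-- The left-invariant vector fields in the chart. -/
theorem mpullbackWithin_mulInvariantVectorField {x : E}
    (hx : x ∈ (extChartAt 𝓘(ℝ, E) (1 : G)).target) (w : GroupLieAlgebra 𝓘(ℝ, E) G) :
    mpullbackWithin 𝓘(ℝ, E) 𝓘(ℝ, E) (extChartAt 𝓘(ℝ, E) (1 : G)).symm
      (mulInvariantVectorField w) (Set.range 𝓘(ℝ, E)) x =
      fderiv ℝ (chartMul E G) (x, chartOne E G) (0, w) := by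
  have : IsManifold 𝓘(ℝ, E) 1 G := .of_le (n := ∞) (by simp)
  refine (isInvertible_mfderivWithin_extChartAt_symm hx).inverse_apply_eq.mpr ?_
  rw [modelWithCornersSelf_coe, Set.range_id, mfderivWithin_univ]
  have hψ := ((contMDiffAt_extChartAt_symm_of_mem_target hx).mdifferentiableAt (by simp))
  have hL := mdifferentiableAt_leftMul_one (E := E) ((extChartAt 𝓘(ℝ, E) (1 : G)).symm x)
  have e1 := hψ.mfderiv_eq_fderiv
  have e2 := hL.mfderiv_eq_fderiv
  have d1 := hψ.differentiableAt_writtenInExtChartAt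
  -- With g the point of coordinates x, left translation by g is, near 1, the inverse chart composed
  -- with m(x, ·); differentiate this at e.
  have key : fderiv ℝ (writtenInExtChartAt 𝓘(ℝ, E) 𝓘(ℝ, E) (1 : G)
      ((extChartAt 𝓘(ℝ, E) (1 : G)).symm x * ·)) (chartOne E G) =
      fderiv ℝ (writtenInExtChartAt 𝓘(ℝ, E) 𝓘(ℝ, E) x (extChartAt 𝓘(ℝ, E) (1 : G)).symm) x ∘L
        (fderiv ℝ (chartMul E G) (x, chartOne E G) ∘L .inr ℝ E E) := by
    have hr := (differentiableAt_chartMul_left hx).hasFDerivAt.comp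
      (f := fun y : E => (x, y)) (chartOne E G) (hasFDerivAt_prodMk_right x (chartOne E G))
    have hmx : (chartMul E G ∘ fun y : E => (x, y)) (chartOne E G) = x := by
      rw [Function.comp_apply, chartMul, extChartAt_symm_chartOne, mul_one,
        (extChartAt 𝓘(ℝ, E) (1 : G)).right_inv hx]
    have d1' := d1.hasFDerivAt
    rw [extChartAt_model_space_eq_id, PartialEquiv.refl_coe, id_eq] at d1'
    have d1'' := d1'
    conv at d1'' => arg 3; rw [← hmx]
    refine ((d1''.comp (chartOne E G) hr).congr_of_eventuallyEq ?_).fderiv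
    have hev : ∀ᶠ y in 𝓝 (chartOne E G), (extChartAt 𝓘(ℝ, E) (1 : G)).symm x *
        (extChartAt 𝓘(ℝ, E) (1 : G)).symm y ∈ (extChartAt 𝓘(ℝ, E) (1 : G)).source := by
      have hc : ContinuousAt (fun y => (extChartAt 𝓘(ℝ, E) (1 : G)).symm x *
          (extChartAt 𝓘(ℝ, E) (1 : G)).symm y) (chartOne E G) := by
        have : ContinuousMul G := continuousMul_of_contMDiffMul 𝓘(ℝ, E) ∞
        exact continuousAt_const.mul (continuousAt_extChartAt_symm 1)
      apply hc.eventually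
      change ∀ᶠ z in 𝓝 ((extChartAt 𝓘(ℝ, E) (1 : G)).symm x *
        (extChartAt 𝓘(ℝ, E) (1 : G)).symm (chartOne E G)), _
      rw [extChartAt_symm_chartOne, mul_one]
      exact extChartAt_source_mem_nhds' ((extChartAt 𝓘(ℝ, E) (1 : G)).map_target hx)
    filter_upwards [hev] with y hy
    simp only [writtenInExtChartAt, Function.comp_apply, chartMul,
      (extChartAt 𝓘(ℝ, E) (1 : G)).left_inv hy, mul_one, extChartAt_model_space_eq_id,
      PartialEquiv.refl_symm, PartialEquiv.refl_coe, id_eq]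
  have e := congrArg (fun T : E →L[ℝ] E => T w) (e2.trans key)
  refine e.trans ?_
  rw [extChartAt_model_space_eq_id] at e1
  exact (congrArg (fun T : E →L[ℝ] E => T (fderiv ℝ (chartMul E G) (x, chartOne E G) (0, w))) e1).symm

end LieGroup

/-! ### The Lie bracket, the derivative of Ad and the orbit differential. -/

section LieGroup

open Filter Topology VectorField

variable {E : Type*} [NormedAddCommGroup E] [NormedSpace ℝ E]
  {G : Type*} [TopologicalSpace G] [ChartedSpace E G] [Group G] [LieGroup 𝓘(ℝ, E) ∞ G]

/-- The tangent space at 1 is read in this very chart, so the chart becomes the identity near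
`chartOne`. -/
theorem mfderiv_extChartAt_one :
    (mfderiv 𝓘(ℝ, E) 𝓘(ℝ, E) (extChartAt 𝓘(ℝ, E) (1 : G)) 1 : E →L[ℝ] E) = .id ℝ E := by
  have : IsManifold 𝓘(ℝ, E) 1 G := .of_le (n := ∞) (by simp)
  have h := mdifferentiableAt_extChartAt (I := 𝓘(ℝ, E)) (mem_chart_source E (1 : G))
  rw [h.mfderiv_eq_fderiv]
  refine ((hasFDerivAt_id _).congr_of_eventuallyEq ?_).fderiv
  filter_upwards [extChartAt_target_mem_nhds (I := 𝓘(ℝ, E)) (1 : G)] with x hx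
  simp only [writtenInExtChartAt, Function.comp_apply, extChartAt_model_space_eq_id,
    PartialEquiv.refl_coe, id_eq, (extChartAt 𝓘(ℝ, E) (1 : G)).right_inv hx]

variable (G) in
/-- The left-invariant vector field of `u` in the preferred chart at `1`. -/
noncomputable def chartInvariantField (u : GroupLieAlgebra 𝓘(ℝ, E) G) : E → E :=
  mpullbackWithin 𝓘(ℝ, E) 𝓘(ℝ, E) (extChartAt 𝓘(ℝ, E) (1 : G)).symm
    (mulInvariantVectorField u) (Set.range 𝓘(ℝ, E))

/-- The Lie bracket as the antisymmetrization of the mixed second derivative of the product. -/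
theorem lie_eq_sub_fderiv_fderiv_chartMul (v w : GroupLieAlgebra 𝓘(ℝ, E) G) :
    (⁅v, w⁆ : GroupLieAlgebra 𝓘(ℝ, E) G) =
      (fderiv ℝ (fderiv ℝ (chartMul E G)) (chartOne E G, chartOne E G) ((v : E), 0) (0, (w : E)) -
        fderiv ℝ (fderiv ℝ (chartMul E G)) (chartOne E G, chartOne E G) ((w : E), 0) (0, (v : E)) :
        E) := by
  have hd2 : HasFDerivAt (fderiv ℝ (chartMul E G))
      (fderiv ℝ (fderiv ℝ (chartMul E G)) (chartOne E G, chartOne E G))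
      (chartOne E G, chartOne E G) :=
    (((contDiffAt_chartMul_chartOne.of_le (m := 2) (by norm_cast)).fderiv_right (m := 1)
      (by norm_num)).differentiableAt
      (by simp)).hasFDerivAt
  have hone : ∀ u : E, fderiv ℝ (chartMul E G) (chartOne E G, chartOne E G) (0, u) = u := by
    intro u
    have h := ((contDiffAt_chartMul_chartOne (E := E) (G := G)).differentiableAt
      (by simp)).hasFDerivAt.comp (f := fun x : E => (chartOne E G, x)) (chartOne E G)
      (hasFDerivAt_prodMk_right _ _)
    exact congrArg (fun T : E →L[ℝ] E => T u)
      (h.unique ((hasFDerivAt_id _).congr_of_eventuallyEq eventually_chartMul_chartOne_left))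
  have hfield (u : GroupLieAlgebra 𝓘(ℝ, E) G) :
      chartInvariantField G u =ᶠ[𝓝 (chartOne E G)]
      fun x => fderiv ℝ (chartMul E G) (x, chartOne E G) (0, (u : E)) := by
    filter_upwards [extChartAt_target_mem_nhds_chartOne] with x hx
    exact mpullbackWithin_mulInvariantVectorField hx u
  have hderiv (u : E) : HasFDerivAt
      (fun x => fderiv ℝ (chartMul E G) (x, chartOne E G) (0, u))
      ((ContinuousLinearMap.apply ℝ E ((0, u) : E × E)) ∘L
        (fderiv ℝ (fderiv ℝ (chartMul E G)) (chartOne E G, chartOne E G) ∘L .inl ℝ E E))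
      (chartOne E G) :=
    (ContinuousLinearMap.apply ℝ E ((0, u) : E × E)).hasFDerivAt.comp _
      (hd2.comp (f := fun x : E => (x, chartOne E G)) _ (hasFDerivAt_prodMk_left _ _))
  have hbr : lieBracketWithin ℝ (chartInvariantField G v) (chartInvariantField G w)
      ((extChartAt 𝓘(ℝ, E) (1 : G)).symm ⁻¹' Set.univ ∩ Set.range 𝓘(ℝ, E)) (chartOne E G) =
      fderiv ℝ (fderiv ℝ (chartMul E G)) (chartOne E G, chartOne E G) ((v : E), 0) (0, (w : E)) -
        fderiv ℝ (fderiv ℝ (chartMul E G)) (chartOne E G, chartOne E G) ((w : E), 0)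
          (0, (v : E)) := by
    rw [modelWithCornersSelf_coe, Set.range_id, Set.preimage_univ, Set.univ_inter,
      lieBracketWithin_univ, (hfield v).lieBracket_vectorField_eq (hfield w), lieBracket, (hderiv v).fderiv,
      (hderiv w).fderiv]
    -- At e the fields V and W take the values v and w, so DW·V − DV·W is the antisymmetrization.
    erw [hone v, hone w]
    rfl
  -- By definition the bracket is the chart bracket pulled back along the chart's derivative at 1.
  -- That derivative enters as a variable `T` so that it can be replaced by the identity.
  have hdef (T : E →L[ℝ] E)
      (hT : T = mfderiv 𝓘(ℝ, E) 𝓘(ℝ, E) (extChartAt 𝓘(ℝ, E) (1 : G)) 1) :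
      (⁅v, w⁆ : GroupLieAlgebra 𝓘(ℝ, E) G) = T.inverse (lieBracketWithin ℝ
        (chartInvariantField G v) (chartInvariantField G w)
        ((extChartAt 𝓘(ℝ, E) (1 : G)).symm ⁻¹' Set.univ ∩ Set.range 𝓘(ℝ, E)) (chartOne E G)) := by
    subst hT; rfl
  rw [hdef _ mfderiv_extChartAt_one.symm, hbr, ContinuousLinearMap.inverse_id]
  rfl

variable [CompleteSpace E]

/-- The derivative of the adjoint action at `1`, in the chart, is the Lie bracket. -/
theorem exists_hasFDerivAt_adjointEnd :
    ∃ F : E →L[ℝ] E →L[ℝ] E,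
      HasFDerivAt (fun y => adjointEnd E ((extChartAt 𝓘(ℝ, E) (1 : G)).symm y)) F (chartOne E G) ∧
      ∀ v w : GroupLieAlgebra 𝓘(ℝ, E) G, F v w = (⁅v, w⁆ : GroupLieAlgebra 𝓘(ℝ, E) G) := by
  obtain ⟨F, hF, h⟩ := exists_hasFDerivAt_of_local_product
    (contDiffAt_chartMul_chartOne.of_le (by norm_cast))
    eventually_chartMul_chartOne_right (eventually_chartMul_chartOne_left (E := E) (G := G))
    (Ad := fun y => adjointEnd E ((extChartAt 𝓘(ℝ, E) (1 : G)).symm y)) <| by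
      filter_upwards [extChartAt_target_mem_nhds_chartOne] with y hy
      exact fderiv_chartMul_comp_adjointEnd hy
  exact ⟨F, hF, fun v w => (h v w).trans (lie_eq_sub_fderiv_fderiv_chartMul v w).symm⟩

/-- The differential at `1` of the orbit map of `z` takes `v` to `w ↦ z ([v, w])`. -/
theorem orbitDifferential_apply (z : ComplexDual (GroupLieAlgebra 𝓘(ℝ, E) G))
    (v w : GroupLieAlgebra 𝓘(ℝ, E) G) : orbitDifferential z v w = z ⁅v, w⁆ := by
  obtain ⟨F, hF, h⟩ := exists_hasFDerivAt_adjointEnd (E := E) (G := G)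
  let z' : E →L[ℝ] ℂ := z
  have hw : writtenInExtChartAt 𝓘(ℝ, E) 𝓘(ℝ, E →L[ℝ] ℂ) (1 : G) (orbitMap z) =
      fun y => z' ∘L adjointEnd E ((extChartAt 𝓘(ℝ, E) (1 : G)).symm y) := by
    ext y
    simp only [writtenInExtChartAt, Function.comp_apply, extChartAt_model_space_eq_id,
      PartialEquiv.refl_coe, id_eq]
    rfl
  have hd : HasFDerivAt (writtenInExtChartAt 𝓘(ℝ, E) 𝓘(ℝ, E →L[ℝ] ℂ) (1 : G) (orbitMap z))
      (ContinuousLinearMap.compL ℝ E E ℂ z' ∘L F) (chartOne E G) := by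
    rw [hw]
    exact (ContinuousLinearMap.compL ℝ E E ℂ z').hasFDerivAt.comp _ hF
  -- `mfderiv` is zero by default off differentiability, which includes continuity on the group;
  -- this is recovered from the chart expression.
  have hc : ContinuousAt (orbitMap z) (1 : G) := by
    have h1 : ContinuousAt
        (writtenInExtChartAt 𝓘(ℝ, E) 𝓘(ℝ, E →L[ℝ] ℂ) (1 : G) (orbitMap z) ∘
          extChartAt 𝓘(ℝ, E) (1 : G)) 1 :=
      ContinuousAt.comp (x := (1 : G)) hd.continuousAt (continuousAt_extChartAt 1)
    refine h1.congr ?_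
    filter_upwards [extChartAt_source_mem_nhds (I := 𝓘(ℝ, E)) (1 : G)] with g hg
    simp only [writtenInExtChartAt, Function.comp_apply, extChartAt_model_space_eq_id,
      PartialEquiv.refl_coe, id_eq, (extChartAt 𝓘(ℝ, E) (1 : G)).left_inv hg]
  have hm : HasMFDerivAt 𝓘(ℝ, E) 𝓘(ℝ, E →L[ℝ] ℂ) (orbitMap z) (1 : G)
      (ContinuousLinearMap.compL ℝ E E ℂ z' ∘L F : E →L[ℝ] (E →L[ℝ] ℂ)) :=
    ⟨hc, hd.hasFDerivWithinAt⟩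
  have he : orbitDifferential z = ContinuousLinearMap.compL ℝ E E ℂ z' ∘L F := hm.mfderiv
  rw [he]
  exact congrArg z' (h v w)

end LieGroup
-- Dimensions of orbits off the irregularity set.
section LieGroup

variable {E : Type*} [NormedAddCommGroup E] [NormedSpace ℝ E] [FiniteDimensional ℝ E]
  [CompleteSpace E] {G : Type*} [TopologicalSpace G] [ChartedSpace E G] [Group G]
  [LieGroup 𝓘(ℝ, E) ∞ G]

instance : FiniteDimensional ℝ (GroupLieAlgebra 𝓘(ℝ, E) G) :=
  inferInstanceAs (FiniteDimensional ℝ E)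

instance : T2Space (GroupLieAlgebra 𝓘(ℝ, E) G) :=
  inferInstanceAs (T2Space E)

variable {z : ComplexDual (GroupLieAlgebra 𝓘(ℝ, E) G)}

/-- The dimension of a coadjoint orbit off the Kronecker irregularity set. -/
theorem finrank_orbitTangent_add_trivialKroneckerDim
    (hz : z ∉ kroneckerIrregularitySet (GroupLieAlgebra 𝓘(ℝ, E) G)) :
    Module.finrank ℝ (orbitTangent z) + trivialKroneckerDim (GroupLieAlgebra 𝓘(ℝ, E) G) =
      Module.finrank ℂ (Complexified (GroupLieAlgebra 𝓘(ℝ, E) G)) :=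
  finrank_range_add_trivialKroneckerDim (z := z) (D := (orbitDifferential z : E →ₗ[ℝ] (E →L[ℝ] ℂ)))
    (orbitDifferential_apply z) hz

/-- The CR dimension of a coadjoint orbit off the Kronecker irregularity set. -/
theorem finrank_holomorphicPart_orbitTangent_add_trivialKroneckerDim
    (hz : z ∉ kroneckerIrregularitySet (GroupLieAlgebra 𝓘(ℝ, E) G)) :
    Module.finrank ℂ (holomorphicPart (orbitTangent z)) +
      trivialKroneckerDim (GroupLieAlgebra 𝓘(ℝ, E) G) =
      algebraRank (GroupLieAlgebra 𝓘(ℝ, E) G) :=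
  finrank_holomorphicPart_add_trivialKroneckerDim (z := z)
    (D := (orbitDifferential z : E →ₗ[ℝ] (E →L[ℝ] ℂ))) (orbitDifferential_apply z) hz

end LieGroup

theorem mainTheorem6
    {E : Type*} [NormedAddCommGroup E] [NormedSpace ℝ E] [FiniteDimensional ℝ E] [CompleteSpace E]
    {G : Type*} [TopologicalSpace G] [ChartedSpace E G] [Group G] [LieGroup 𝓘(ℝ, E) ∞ G]
    [ConnectedSpace G]
    (z₀ : ComplexDual (GroupLieAlgebra 𝓘(ℝ, E) G))
    (hO : Disjoint (coadjointOrbit z₀)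
      (kroneckerIrregularitySet (GroupLieAlgebra 𝓘(ℝ, E) G))) :
    (∀ z ∈ coadjointOrbit z₀,
      (Module.finrank ℂ (holomorphicPart (orbitTangent z)) : ℤ) =
        (algebraRank (GroupLieAlgebra 𝓘(ℝ, E) G) : ℤ) -
          (trivialKroneckerDim (GroupLieAlgebra 𝓘(ℝ, E) G) : ℤ)) ∧
    (LieAlgebra.IsSemisimple ℂ (Complexified (GroupLieAlgebra 𝓘(ℝ, E) G)) →
      ∀ z ∈ coadjointOrbit z₀,
        Module.finrank ℂ (holomorphicPart (orbitTangent z)) =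
          algebraRank (GroupLieAlgebra 𝓘(ℝ, E) G)) ∧
    (∀ z ∈ coadjointOrbit z₀,
      (Module.finrank ℝ (orbitTangent z) : ℤ) =
        (Module.finrank ℂ (Complexified (GroupLieAlgebra 𝓘(ℝ, E) G)) : ℤ) -
          (trivialKroneckerDim (GroupLieAlgebra 𝓘(ℝ, E) G) : ℤ)) := by
  have hz : ∀ z ∈ coadjointOrbit z₀, z ∉ kroneckerIrregularitySet (GroupLieAlgebra 𝓘(ℝ, E) G) :=
    fun z h => Set.disjoint_left.mp hO h
  refine ⟨fun z h => ?_, fun _ z h => ?_, fun z h => ?_⟩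
  · rw [← finrank_holomorphicPart_orbitTangent_add_trivialKroneckerDim (hz z h)]
    simp
  · rw [← finrank_holomorphicPart_orbitTangent_add_trivialKroneckerDim (hz z h),
      trivialKroneckerDim_eq_zero_of_isSemisimple, add_zero]
  · rw [← finrank_orbitTangent_add_trivialKroneckerDim (hz z h)]
    simp
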